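/- Let $M$ be a real analytic submanifold of $\mathbb{C}^n\cong\mathbb{R}^{2n}$ of real dimension $d$. Suppose that $M$ is a CR manifold of CR dimension $m\ge 0$; that is, for every $p\in M$ the largest complex dimension of a complex linear subspace of $\mathbb{C}^n$ contained in the tangent space $T_pM$ is equal to $m$ (so that $m\le d$). Then for every $p\in M$ the smallest complex analytic germ $X_p$ at $p$ that contains the germ $M_p$ exists and satisfies $$\dim_{HC}M_p:=\dim_{\mathbb{C}}X_p=d-m .$$ -/

import Mathlib

open scoped Topology

/-- `M` is a (locally closed, embedded) `𝕜`-analytic submanifold of `E`, of pure dimension `d`: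
near each of its points there is a `𝕜`-analytic diffeomorphism `Φ` between open subsets of `E`
that carries `M` to a `d`-dimensional linear subspace. For `𝕜 = ℝ` these are the real analytic
submanifolds, for `𝕜 = ℂ` the complex submanifolds. -/
def IsAnalyticSubmanifold (𝕜 : Type*) [NontriviallyNormedField 𝕜] {E : Type*}
    [NormedAddCommGroup E] [NormedSpace 𝕜 E] (d : ℕ) (M : Set E) : Prop :=
  ∀ p ∈ M, ∃ (Φ : OpenPartialHomeomorph E E) (L : Submodule 𝕜 E),
    p ∈ Φ.source ∧
    AnalyticOnNhd 𝕜 Φ Φ.source ∧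
    AnalyticOnNhd 𝕜 Φ.symm Φ.target ∧
    Module.finrank 𝕜 L = d ∧
    ∀ x ∈ Φ.source, x ∈ M ↔ Φ x ∈ L

/-- The tangent space of `M` at `p`, as a real linear subspace of the ambient space: the span of
the velocities at `p` of the curves in `M` through `p`. (At a point of a submanifold these
velocities already form a linear subspace.) -/
def tangentSubspace {E : Type*} [NormedAddCommGroup E] [NormedSpace ℝ E]
    (M : Set E) (p : E) : Submodule ℝ E :=
  Submodule.span ℝ
    {v | ∃ γ : ℝ → E, γ 0 = p ∧ (∀ᶠ t in 𝓝 (0 : ℝ), γ t ∈ M) ∧ HasDerivAt γ v 0}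

/-- The real subspace `L` of a complex vector space has CR dimension `m`: the largest complex
dimension of a complex linear subspace contained in `L` is `m`. -/
def HasCRDim {E : Type*} [NormedAddCommGroup E] [NormedSpace ℂ E]
    (L : Submodule ℝ E) (m : ℕ) : Prop :=
  IsGreatest {k : ℕ | ∃ C : Submodule ℂ E, (C : Set E) ⊆ L ∧ Module.finrank ℂ C = k} m

/-- `M` is a real analytic CR manifold of real dimension `d` and CR dimension `m`: a real analytic
submanifold of dimension `d` all of whose tangent spaces have CR dimension `m`. -/
def IsRealAnalyticCRManifold {E : Type*} [NormedAddCommGroup E] [NormedSpace ℂ E]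
    (d m : ℕ) (M : Set E) : Prop :=
  IsAnalyticSubmanifold ℝ d M ∧ ∀ p ∈ M, HasCRDim (tangentSubspace M p) m

/-- The germ of `X` at `p` is the germ of a complex analytic set: near `p`, `X` is the common zero
locus of finitely many functions that are holomorphic in a neighbourhood of `p`. -/
def IsComplexAnalyticGerm {E : Type*} [NormedAddCommGroup E] [NormedSpace ℂ E]
    (X : Set E) (p : E) : Prop :=
  ∃ (t : ℕ) (g : Fin t → E → ℂ), (∀ k, AnalyticAt ℂ (g k) p) ∧
    ∀ᶠ z in 𝓝 p, z ∈ X ↔ ∀ k, g k z = 0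

/-- Inclusion of the germs at `p` of two sets. -/
def GermSubset {E : Type*} [TopologicalSpace E] (p : E) (X Y : Set E) : Prop :=
  ∀ᶠ z in 𝓝 p, z ∈ X → z ∈ Y

/-- The germ of `X` at `p` is the smallest complex analytic germ that contains the germ of `R`
at `p`. -/
def IsHolomorphicClosureGerm {E : Type*} [NormedAddCommGroup E] [NormedSpace ℂ E]
    (R : Set E) (p : E) (X : Set E) : Prop :=
  (IsComplexAnalyticGerm X p ∧ GermSubset p R X) ∧
    ∀ Y : Set E, IsComplexAnalyticGerm Y p → GermSubset p R Y → GermSubset p X Y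

/-- The complex dimension of a set: the largest dimension of a nonempty complex submanifold
contained in it (and `⊥` for the empty set). -/
noncomputable def complexDim {E : Type*} [NormedAddCommGroup E] [NormedSpace ℂ E]
    (X : Set E) : WithBot ℕ∞ :=
  ⨆ (k : ℕ) (_ : ∃ N : Set E, N.Nonempty ∧ N ⊆ X ∧ IsAnalyticSubmanifold ℂ k N),
    ((k : ℕ∞) : WithBot ℕ∞)

/-- The complex dimension of the germ of a set at `p`: the least dimension of its intersection with
an open neighbourhood of `p`. -/
noncomputable def complexGermDim {E : Type*} [NormedAddCommGroup E] [NormedSpace ℂ E]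
    (X : Set E) (p : E) : WithBot ℕ∞ :=
  ⨅ (U : Set E) (_ : IsOpen U) (_ : p ∈ U), complexDim (X ∩ U)

/-- `R` has holomorphic closure dimension `h` at `p`: there is a smallest complex analytic germ at
`p` containing the germ of `R` (a germ that is then unique), and every set representing it has
germ dimension `h` at `p`. -/
def HasHolomorphicClosureDim {E : Type*} [NormedAddCommGroup E] [NormedSpace ℂ E]
    (R : Set E) (p : E) (h : ℕ) : Prop :=
  (∃ X : Set E, IsHolomorphicClosureGerm R p X) ∧
    ∀ X : Set E, IsHolomorphicClosureGerm R p X → complexGermDim X p = ((h : ℕ∞) : WithBot ℕ∞)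

/-! Near `p`, parametrize `M` by a real analytic immersion `γ` of a neighbourhood of `0` in `ℝ^d`,
and extend its power series to a holomorphic map `ψ` near `0` in `ℂ^d`. At a real point `x` the
image of `dψ` is the complex span `T + iT` of `T = T_{γ(x)}M`. Since `T ∩ iT` has complex dimension
`m`, that span has complex dimension `d - m` (`HasCRDim.add_finrank_span`,
`finrank_range_fderiv_complexification`).

The CR condition thus makes the rank of `dψ` constant, but only along `ℝ^d`. In
`AnalyticAt.eventually_ker_of_constant_rank_real` the rank condition becomes the vanishing of a
holomorphic germ, which spreads from `ℝ^d` to `ℂ^d` by the identity theorem. The constant rank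
argument of `AnalyticAt.exists_section_of_constant_rank_real` then shows that the germ of the image
of `ψ` is that of a complex submanifold `X` of dimension `d - m`, and it contains `M` near `p`.

Minimality uses the identity theorem again: if `g` is holomorphic at `p` and vanishes on `M`, then
`g ∘ ψ` vanishes on `ℝ^d`, hence near `0` in `ℂ^d`, so `g` vanishes on `X`. -/

open Module

/-! ### Complex span of a real subspace -/

section LinearAlgebra

variable {E : Type*} [NormedAddCommGroup E] [NormedSpace ℂ E] [FiniteDimensional ℂ E]

/-- `T ∩ iT` is the largest complex subspace of `T` and `T + iT` is its complex span, so this is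
half of the real dimension formula for the pair `T`, `iT`. -/
theorem HasCRDim.add_finrank_span {T : Submodule ℝ E} {m : ℕ} (h : HasCRDim T m) :
    m + finrank ℂ (Submodule.span ℂ (T : Set E)) = finrank ℝ T := by
  have hfin : FiniteDimensional ℝ E := FiniteDimensional.complexToReal E
  let J : E ≃ₗ[ℝ] E :=
    (LinearEquiv.smulOfNeZero ℂ E Complex.I Complex.I_ne_zero).restrictScalars ℝ
  have hJ : ∀ x, J x = Complex.I • x := fun x => rfl
  have hJJ : ∀ x, J (J x) = -x := fun x => by
    rw [hJ, hJ, smul_smul, Complex.I_mul_I, neg_one_smul]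
  have smul_eq : ∀ (c : ℂ) (x : E), c • x = c.re • x + c.im • J x := fun c x => by
    rw [hJ]
    conv_lhs => rw [← Complex.re_add_im c, add_smul, mul_smul]
    rw [Complex.coe_smul, Complex.coe_smul]
  -- Since `J² = -1`, the vectors `x` with `x` and `J x` both in `T` form exactly `T ∩ iT`.
  let C : Submodule ℂ E :=
    { carrier := {x | x ∈ T ∧ J x ∈ T}
      add_mem' := fun {a b} ha hb =>
        ⟨T.add_mem ha.1 hb.1, by rw [map_add]; exact T.add_mem ha.2 hb.2⟩
      zero_mem' := ⟨T.zero_mem, by rw [map_zero]; exact T.zero_mem⟩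
      smul_mem' := fun c x hx => by
        refine ⟨?_, ?_⟩
        · rw [smul_eq]
          exact T.add_mem (T.smul_mem _ hx.1) (T.smul_mem _ hx.2)
        · rw [smul_eq, map_add, map_smul, map_smul, hJJ]
          exact T.add_mem (T.smul_mem _ hx.2) (T.smul_mem _ (T.neg_mem hx.1)) }
  have hC : C.restrictScalars ℝ = T ⊓ T.map (J : E →ₗ[ℝ] E) := by
    ext x
    constructor
    · rintro ⟨h1, h2⟩
      exact ⟨h1, -J x, T.neg_mem h2, by simp [hJJ]⟩
    · rintro ⟨h1, y, hy, rfl⟩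
      exact ⟨h1, by simpa [hJJ] using hy⟩
  have hS : (Submodule.span ℂ (T : Set E)).restrictScalars ℝ = T ⊔ T.map (J : E →ₗ[ℝ] E) := by
    apply le_antisymm
    · let S : Submodule ℂ E :=
        { T ⊔ T.map (J : E →ₗ[ℝ] E) with
          smul_mem' := fun c x hx => by
            obtain ⟨a, ha, _, ⟨b, hb, rfl⟩, rfl⟩ := Submodule.mem_sup.1 hx
            refine Submodule.mem_sup.2 ⟨c.re • a - c.im • b, T.sub_mem (T.smul_mem _ ha)
              (T.smul_mem _ hb), _, ⟨c.im • a + c.re • b, T.add_mem (T.smul_mem _ ha)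
              (T.smul_mem _ hb), rfl⟩, ?_⟩
            have : ((J : E →ₗ[ℝ] E) b) = J b := rfl
            rw [this, smul_add, smul_eq c a, smul_eq c (J b), hJJ]
            simp only [LinearEquiv.coe_coe, map_add, map_smul]
            module }
      have : Submodule.span ℂ (T : Set E) ≤ S :=
        Submodule.span_le.2 fun x hx => (le_sup_left : T ≤ T ⊔ T.map (J : E →ₗ[ℝ] E)) hx
      exact fun x hx => this hx
    · refine sup_le (fun x hx => Submodule.subset_span hx) ?_
      rintro _ ⟨y, hy, rfl⟩
      exact (Submodule.span ℂ (T : Set E)).smul_mem Complex.I (Submodule.subset_span hy)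
  have hm : m = finrank ℂ C := by
    apply le_antisymm
    · obtain ⟨C', hC', rfl⟩ := h.1
      exact Submodule.finrank_mono fun x hx => ⟨hC' hx, hC' (C'.smul_mem Complex.I hx)⟩
    · exact h.2 ⟨C, fun x hx => hx.1, rfl⟩
  have key := Submodule.finrank_sup_add_finrank_inf_eq T (T.map (J : E →ₗ[ℝ] E))
  rw [LinearEquiv.finrank_map_eq J T, ← hS, ← hC] at key
  have h1 : finrank ℝ (C.restrictScalars ℝ) = 2 * finrank ℂ C := finrank_real_of_complex C
  have h2 : finrank ℝ ((Submodule.span ℂ (T : Set E)).restrictScalars ℝ)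
    = 2 * finrank ℂ (Submodule.span ℂ (T : Set E)) := finrank_real_of_complex _
  omega

end LinearAlgebra

/-! ### Complexification of real analytic germs and the identity theorem -/

/-- The inclusion `ℝ^d → ℂ^d` as a real continuous linear map. -/
noncomputable def realInclusion (d : ℕ) : (Fin d → ℝ) →L[ℝ] (Fin d → ℂ) :=
  ContinuousLinearMap.pi fun i => Complex.ofRealCLM.comp (ContinuousLinearMap.proj i)

@[simp] theorem realInclusion_apply (d : ℕ) (x : Fin d → ℝ) (i : Fin d) :
    realInclusion d x i = (x i : ℂ) := rfl

section Complexification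

variable {d : ℕ} {G : Type*} [NormedAddCommGroup G] [NormedSpace ℂ G]

/-- A holomorphic germ at the origin of `ℂ^d` that vanishes on `ℝ^d` vanishes. -/
theorem AnalyticAt.eventually_eq_zero_of_realInclusion [CompleteSpace G] {F : (Fin d → ℂ) → G}
    (hF : AnalyticAt ℂ F 0) (h0 : ∀ᶠ x in 𝓝 (0 : Fin d → ℝ), F (realInclusion d x) = 0) :
    ∀ᶠ z in 𝓝 (0 : Fin d → ℂ), F z = 0 := by
  obtain ⟨r, hr, hFr⟩ := Metric.eventually_nhds_iff.1 hF.eventually_analyticAt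
  obtain ⟨s, hs, h0s⟩ := Metric.eventually_nhds_iff.1 h0
  -- On the line `ℓ` below, `‖t‖ < 3/2` gives norm at most `(5/2)‖z‖ < r`, and real `|t| < 1` gives
  -- norm at most `2‖z‖ < s`.
  refine Metric.eventually_nhds_iff.2 ⟨min (r / 3) (s / 2), by positivity, fun z hz => ?_⟩
  rw [dist_zero_right, lt_min_iff] at hz
  let x : Fin d → ℝ := fun i => (z i).re
  let y : Fin d → ℝ := fun i => (z i).im
  have hx : ‖x‖ ≤ ‖z‖ := (pi_norm_le_iff_of_nonneg (norm_nonneg _)).2 fun i =>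
    (Complex.abs_re_le_norm (z i)).trans (norm_le_pi_norm z i)
  have hy : ‖y‖ ≤ ‖z‖ := (pi_norm_le_iff_of_nonneg (norm_nonneg _)).2 fun i =>
    (Complex.abs_im_le_norm (z i)).trans (norm_le_pi_norm z i)
  have hincl : ∀ w : Fin d → ℝ, ‖realInclusion d w‖ ≤ ‖w‖ := fun w =>
    (pi_norm_le_iff_of_nonneg (norm_nonneg _)).2 fun i => by
      simpa using norm_le_pi_norm w i
  -- This complex line is real at real `t` and passes through `z` at `t = i`. The one-variable
  -- identity theorem on the disc of radius `3/2`, which contains both `0` and `i`, therefore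
  -- suffices.
  let ℓ : ℂ → (Fin d → ℂ) := fun t => realInclusion d x + t • realInclusion d y
  have hℓ : ∀ t ∈ Metric.ball (0 : ℂ) (3 / 2), AnalyticAt ℂ (F ∘ ℓ) t := fun t ht => by
    have hℓa : AnalyticAt ℂ ℓ t := by
      apply AnalyticAt.add analyticAt_const
      exact analyticAt_id.smul analyticAt_const
    refine AnalyticAt.comp (hFr ?_) hℓa
    rw [mem_ball_zero_iff] at ht
    rw [dist_zero_right]
    calc ‖ℓ t‖ ≤ ‖realInclusion d x‖ + ‖t‖ * ‖realInclusion d y‖ := by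
          rw [← norm_smul]; exact norm_add_le _ _
      _ ≤ ‖z‖ + 3 / 2 * ‖z‖ := by
          gcongr
          · exact (hincl x).trans hx
          · exact (hincl y).trans hy
      _ < r := by linarith [norm_nonneg z]
  have hzero : ∃ᶠ t in 𝓝[≠] (0 : ℂ), (F ∘ ℓ) t = 0 := by
    have hreal : ∀ᶠ t in 𝓝[≠] (0 : ℝ), (F ∘ ℓ) (Complex.ofReal t) = 0 := by
      refine eventually_nhdsWithin_of_eventually_nhds
        (Metric.eventually_nhds_iff.2 ⟨1, one_pos, fun t ht => ?_⟩)
      have : ℓ (Complex.ofReal t) = realInclusion d (x + t • y) := by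
        ext i; simp [ℓ]
      rw [Function.comp_apply, this]
      apply h0s
      rw [dist_zero_right] at ht ⊢
      calc ‖x + t • y‖ ≤ ‖x‖ + ‖t‖ * ‖y‖ := by
            rw [← norm_smul]; exact norm_add_le _ _
        _ ≤ ‖z‖ + 1 * ‖z‖ := by gcongr
        _ < s := by linarith
    have htend : Filter.Tendsto (fun t : ℝ => (t : ℂ)) (𝓝[≠] 0) (𝓝[≠] 0) := by
      refine tendsto_nhdsWithin_iff.2 ⟨?_, ?_⟩
      · exact (Complex.continuous_ofReal.tendsto' 0 0 (by simp)).mono_left nhdsWithin_le_nhds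
      · exact eventually_mem_nhdsWithin.mono fun t ht => by simpa using ht
    exact htend.frequently hreal.frequently
  have hball : IsPreconnected (Metric.ball (0 : ℂ) (3 / 2)) :=
    (convex_ball _ _).isPreconnected
  have := AnalyticOnNhd.eqOn_zero_of_preconnected_of_frequently_eq_zero hℓ hball
    (Metric.mem_ball_self (by norm_num)) hzero (show Complex.I ∈ _ by simp; norm_num)
  have hI : ℓ Complex.I = z := by
    ext i
    simp only [ℓ, x, y, Pi.add_apply, Pi.smul_apply, realInclusion_apply, smul_eq_mul]
    rw [mul_comm, Complex.re_add_im]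
  simpa [hI] using this

/-- The complexification of a real continuous multilinear form on `ℝ^d`. -/
noncomputable def ContinuousMultilinearMap.complexify {n : ℕ}
    (p : ContinuousMultilinearMap ℝ (fun _ : Fin n => (Fin d → ℝ)) G) :
    ContinuousMultilinearMap ℂ (fun _ : Fin n => (Fin d → ℂ)) G :=
  ∑ j : Fin n → Fin d, (((ContinuousMultilinearMap.mkPiAlgebra ℂ (Fin n) ℂ).compContinuousLinearMap
    fun i => ContinuousLinearMap.proj (j i)).smulRight (p fun i => Pi.single (j i) 1))

theorem ContinuousMultilinearMap.complexify_apply {n : ℕ}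
    (p : ContinuousMultilinearMap ℝ (fun _ : Fin n => (Fin d → ℝ)) G) (z : Fin n → Fin d → ℂ) :
    p.complexify z = ∑ j : Fin n → Fin d, (∏ i, z i (j i)) • p fun i => Pi.single (j i) 1 := by
  simp [complexify]

theorem ContinuousMultilinearMap.complexify_realInclusion {n : ℕ}
    (p : ContinuousMultilinearMap ℝ (fun _ : Fin n => (Fin d → ℝ)) G) (x : Fin n → Fin d → ℝ) :
    (p.complexify fun i => realInclusion d (x i)) = p x := by
  classical
  have hx : x = fun i => ∑ k, x i k • (Pi.single k 1 : Fin d → ℝ) := by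
    funext i
    exact pi_eq_sum_univ' (x i)
  rw [complexify_apply]
  conv_rhs => rw [hx, ContinuousMultilinearMap.map_sum]
  refine Finset.sum_congr rfl fun j _ => ?_
  rw [ContinuousMultilinearMap.map_smul_univ, ← Complex.coe_smul]
  simp

/-- The basis expansion has `d ^ n` terms, each bounded by `‖p‖`. The loss is only geometric in `n`,
so a positive radius of convergence survives complexification. -/
theorem ContinuousMultilinearMap.norm_complexify_le {n : ℕ}
    (p : ContinuousMultilinearMap ℝ (fun _ : Fin n => (Fin d → ℝ)) G) :
    ‖p.complexify‖ ≤ (d : ℝ) ^ n * ‖p‖ := by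
  refine ContinuousMultilinearMap.opNorm_le_bound (by positivity) fun z => ?_
  rw [complexify_apply]
  refine (norm_sum_le _ _).trans ?_
  have : ∀ j ∈ (Finset.univ : Finset (Fin n → Fin d)),
      ‖(∏ i, z i (j i)) • p fun i => Pi.single (j i) 1‖ ≤ (∏ i, ‖z i‖) * ‖p‖ := by
    intro j _
    rw [norm_smul, norm_prod]
    gcongr with i _
    · exact norm_le_pi_norm (z i) (j i)
    · refine (p.le_opNorm _).trans (le_of_eq ?_)
      rw [Finset.prod_eq_one fun i _ => ?_, mul_one]
      rw [Pi.norm_single, norm_one]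
  refine (Finset.sum_le_card_nsmul _ _ _ this).trans (le_of_eq ?_)
  simp
  ring

/-- Complexification of real analytic germs. -/
theorem AnalyticAt.exists_complexification [CompleteSpace G] {f : (Fin d → ℝ) → G}
    (hf : AnalyticAt ℝ f 0) :
    ∃ F : (Fin d → ℂ) → G, AnalyticAt ℂ F 0 ∧
      ∀ᶠ x in 𝓝 (0 : Fin d → ℝ), F (realInclusion d x) = f x := by
  obtain ⟨p, hp⟩ := hf
  let q : FormalMultilinearSeries ℂ (Fin d → ℂ) G := fun n => (p n).complexify
  obtain ⟨C, a, hC, ha, hpa⟩ := p.le_mul_pow_of_radius_pos hp.radius_pos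
  have hq : 0 < q.radius := by
    -- The factor `d + 1` instead of `d` keeps the inverse meaningful when `d = 0`.
    let s : NNReal := (⟨(d + 1) * a, by positivity⟩ : NNReal)⁻¹
    have hs : 0 < s := inv_pos.2 (show (0 : ℝ) < (d + 1) * a by positivity)
    refine lt_of_lt_of_le (ENNReal.coe_pos.2 hs) (q.le_radius_of_bound C fun n => ?_)
    have hsr : (s : ℝ) = ((d + 1) * a)⁻¹ := rfl
    calc ‖q n‖ * (s : ℝ) ^ n ≤ ((d : ℝ) ^ n * ‖p n‖) * (s : ℝ) ^ n := by
          gcongr; exact (p n).norm_complexify_le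
      _ ≤ (((d : ℝ) + 1) ^ n * (C * a ^ n)) * (s : ℝ) ^ n := by
          gcongr
          · linarith
          · exact hpa n
      _ = C * (((d + 1) * a) * s) ^ n := by simp only [mul_pow]; ring
      _ = C := by rw [hsr, mul_inv_cancel₀ (by positivity), one_pow, mul_one]
  have hqs := q.hasFPowerSeriesOnBall hq
  refine ⟨q.sum, hqs.analyticAt, ?_⟩
  filter_upwards [hp.eventually_hasSum] with x hx
  rw [zero_add] at hx
  rw [← hx.tsum_eq, FormalMultilinearSeries.sum]
  refine tsum_congr fun n => ?_
  exact (p n).complexify_realInclusion fun _ => x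

end Complexification

/-! ### Derivatives of local diffeomorphisms and of curves in subspaces -/

section Flattening

variable {𝕜 : Type*} [NontriviallyNormedField 𝕜] {E : Type*} [NormedAddCommGroup E]
  [NormedSpace 𝕜 E] {F : Type*} [NormedAddCommGroup F] [NormedSpace 𝕜 F]

theorem OpenPartialHomeomorph.fderiv_comp_fderiv_symm (Φ : OpenPartialHomeomorph E F) {a : F}
    (ha : a ∈ Φ.target) (h₁ : DifferentiableAt 𝕜 Φ (Φ.symm a))
    (h₂ : DifferentiableAt 𝕜 Φ.symm a) :
    (fderiv 𝕜 Φ (Φ.symm a)).comp (fderiv 𝕜 Φ.symm a) = ContinuousLinearMap.id 𝕜 F := by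
  have h := h₁.hasFDerivAt.comp a h₂.hasFDerivAt
  refine h.unique ((hasFDerivAt_id a).congr_of_eventuallyEq ?_)
  filter_upwards [Φ.open_target.mem_nhds ha] with y hy
  exact Φ.right_inv hy

theorem OpenPartialHomeomorph.fderiv_symm_comp_fderiv (Φ : OpenPartialHomeomorph E F) {a : F}
    (ha : a ∈ Φ.target) (h₁ : DifferentiableAt 𝕜 Φ (Φ.symm a))
    (h₂ : DifferentiableAt 𝕜 Φ.symm a) :
    (fderiv 𝕜 Φ.symm a).comp (fderiv 𝕜 Φ (Φ.symm a)) = ContinuousLinearMap.id 𝕜 E := by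
  have h := Φ.symm.fderiv_comp_fderiv_symm (𝕜 := 𝕜) (a := Φ.symm a) (Φ.map_target ha)
    (by rw [Φ.symm_symm, Φ.right_inv ha]; exact h₂) (by rw [Φ.symm_symm]; exact h₁)
  rwa [Φ.symm_symm, Φ.right_inv ha] at h

theorem Submodule.exists_continuous_projection [CompleteSpace 𝕜] [FiniteDimensional 𝕜 E]
    (W : Submodule 𝕜 E) :
    ∃ π : E →L[𝕜] W, ∀ w : W, π w = w := by
  obtain ⟨g, hg⟩ := LinearMap.exists_leftInverse_of_injective W.subtype W.ker_subtype
  exact ⟨LinearMap.toContinuousLinearMap g, fun w => LinearMap.congr_fun hg w⟩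

/-- The derivative of a curve that stays in a linear subspace belongs to it. -/
theorem Submodule.mem_of_hasFDerivAt [CompleteSpace 𝕜] [FiniteDimensional 𝕜 E]
    (W : Submodule 𝕜 E) {c : F → E} {x : F}
    {c' : F →L[𝕜] E} (hc : HasFDerivAt c c' x) (hW : ∀ᶠ t in 𝓝 x, c t ∈ W) (v : F) :
    c' v ∈ W := by
  obtain ⟨π, hπ⟩ := W.exists_continuous_projection
  have h : HasFDerivAt c ((W.subtypeL.comp π).comp c') x := by
    refine (((W.subtypeL.comp π).hasFDerivAt).comp x hc).congr_of_eventuallyEq ?_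
    filter_upwards [hW] with t ht
    simp [hπ ⟨c t, ht⟩]
  rw [hc.unique h]
  exact (π (c' v)).2

end Flattening

/-! ### Immersive parametrizations of real analytic submanifolds -/

section Parametrization

variable {E : Type*} [NormedAddCommGroup E] [NormedSpace ℝ E] [FiniteDimensional ℝ E]

/-- Near each of its points, a real analytic submanifold has an analytic parametrization that is an
immersion onto a neighbourhood of the point. -/
theorem IsAnalyticSubmanifold.exists_parametrization {d : ℕ} {M : Set E}
    (hM : IsAnalyticSubmanifold ℝ d M) {p : E} (hp : p ∈ M) :
    ∃ γ : (Fin d → ℝ) → E, AnalyticAt ℝ γ 0 ∧ γ 0 = p ∧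
      (∀ᶠ x in 𝓝 (0 : Fin d → ℝ), γ x ∈ M ∧ Function.Injective (fderiv ℝ γ x) ∧
        tangentSubspace M (γ x) = LinearMap.range (fderiv ℝ γ x).toLinearMap) ∧
      ∀ N ∈ 𝓝 (0 : Fin d → ℝ), ∀ᶠ e in 𝓝 p, e ∈ M → e ∈ γ '' N := by
  obtain ⟨Φ, L, hpΦ, hΦ, hΦs, hL, hML⟩ := hM p hp
  have hpL : Φ p ∈ L := (hML p hpΦ).1 hp
  let ℓ : (Fin d → ℝ) ≃L[ℝ] L := ContinuousLinearEquiv.ofFinrankEq (by simp [hL])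
  let ι : (Fin d → ℝ) →L[ℝ] E := L.subtypeL.comp (ℓ : (Fin d → ℝ) →L[ℝ] L)
  have hιL : ∀ x, ι x ∈ L := fun x => (ℓ x).2
  have hιinj : Function.Injective ι := Subtype.val_injective.comp ℓ.injective
  -- Because `Φ p ∈ L`, translation by `Φ p` keeps the image in `L` and moves the base point to
  -- parameter `0`.
  let α : (Fin d → ℝ) → E := fun x => Φ p + ι x
  have hα0 : α 0 = Φ p := by simp [α]
  have hαc : Continuous α := continuous_const.add ι.continuous
  have hαd : ∀ x, HasFDerivAt α ι x := fun x => ι.hasFDerivAt.const_add _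
  have hαL : ∀ x, α x ∈ L := fun x => L.add_mem hpL (hιL x)
  have hαt : ∀ᶠ x in 𝓝 (0 : Fin d → ℝ), α x ∈ Φ.target :=
    hαc.continuousAt.eventually_mem
      (Φ.open_target.mem_nhds (by rw [hα0]; exact Φ.map_source hpΦ))
  have hmem : ∀ x, α x ∈ Φ.target → Φ.symm (α x) ∈ M := fun x hx => by
    rw [hML _ (Φ.map_target hx), Φ.right_inv hx]
    exact hαL x
  refine ⟨fun x => Φ.symm (α x), ?_, ?_, ?_, ?_⟩
  · refine AnalyticAt.comp (hΦs _ ?_) (analyticAt_const.add (ι.analyticAt 0))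
    rw [hα0]
    exact Φ.map_source hpΦ
  · change Φ.symm (α 0) = p
    rw [hα0, Φ.left_inv hpΦ]
  · filter_upwards [hαt] with x hx
    have d₁ : DifferentiableAt ℝ Φ (Φ.symm (α x)) :=
      (hΦ _ (Φ.map_target hx)).differentiableAt
    have d₂ : DifferentiableAt ℝ Φ.symm (α x) := (hΦs _ hx).differentiableAt
    set A := fderiv ℝ Φ (Φ.symm (α x)) with hA
    set B := fderiv ℝ Φ.symm (α x) with hB
    have hAB : A.comp B = ContinuousLinearMap.id ℝ E := Φ.fderiv_comp_fderiv_symm hx d₁ d₂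
    have hBA : B.comp A = ContinuousLinearMap.id ℝ E := Φ.fderiv_symm_comp_fderiv hx d₁ d₂
    have hd : HasFDerivAt (fun x => Φ.symm (α x)) (B.comp ι) x :=
      d₂.hasFDerivAt.comp x (hαd x)
    rw [hd.fderiv]
    refine ⟨hmem x hx, ?_, le_antisymm ?_ ?_⟩
    · have hBinj : Function.Injective B :=
        Function.LeftInverse.injective (g := A) fun e => DFunLike.congr_fun hAB e
      exact hBinj.comp hιinj
    -- The image under `Φ` of a curve in `M` stays in `L`, so its velocity `A v` lies in `L`, and `v
    -- = B (A v)`.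
    · refine Submodule.span_le.2 ?_
      rintro v ⟨c, hc0, hcM, hcv⟩
      have hcc : ContinuousAt c 0 := hcv.continuousAt
      have hcs : ∀ᶠ t in 𝓝 (0 : ℝ), c t ∈ Φ.source := hcc.eventually_mem
        (Φ.open_source.mem_nhds (by rw [hc0]; exact Φ.map_target hx))
      have hcd : HasFDerivAt (fun t => Φ (c t))
          (A.comp (ContinuousLinearMap.toSpanSingleton ℝ v)) 0 := by
        have d₁' : HasFDerivAt Φ A (c 0) := by rw [hc0]; exact d₁.hasFDerivAt
        exact d₁'.comp 0 hcv.hasFDerivAt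
      have hAv := L.mem_of_hasFDerivAt hcd
        (by filter_upwards [hcM, hcs] with t h1 h2 using (hML _ h2).1 h1) 1
      simp only [ContinuousLinearMap.comp_apply,
        ContinuousLinearMap.toSpanSingleton_apply, one_smul] at hAv
      refine ⟨ℓ.symm ⟨A v, hAv⟩, ?_⟩
      have : ι (ℓ.symm ⟨A v, hAv⟩) = A v := by simp [ι]
      change B (ι _) = v
      rw [this]
      exact DFunLike.congr_fun hBA v
    -- The image of the straight line through `x` in direction `u` is a curve in `M` with the
    -- required velocity.
    · rintro _ ⟨u, rfl⟩
      refine Submodule.subset_span ⟨fun t => Φ.symm (α (x + t • u)), by simp, ?_, ?_⟩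
      · have hcont : Continuous fun t : ℝ => α (x + t • u) := by fun_prop
        have : ∀ᶠ t in 𝓝 (0 : ℝ), α (x + t • u) ∈ Φ.target :=
          hcont.continuousAt.eventually_mem (Φ.open_target.mem_nhds (by simpa using hx))
        filter_upwards [this] with t ht using hmem _ ht
      · have hline : HasDerivAt (fun t : ℝ => x + t • u) u 0 := by
          simpa using ((hasDerivAt_id (0 : ℝ)).smul_const u).const_add x
        have hd' : HasFDerivAt (fun x => Φ.symm (α x)) (B.comp ι) (x + (0 : ℝ) • u) := by
          simpa using hd
        exact HasFDerivAt.comp_hasDerivAt (f := fun t : ℝ => x + t • u)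
          (l := fun x => Φ.symm (α x)) 0 hd' hline
  · intro N hN
    -- A projection onto `L` extends the parameter of a point of `M` to a continuous function of all
    -- nearby `e`, with value `0` at `p`.
    have hc : ContinuousAt (fun e => (ℓ.symm : L → Fin d → ℝ)
        ((L.exists_continuous_projection.choose) (Φ e - Φ p))) p := by
      have : ContinuousAt Φ p := Φ.continuousAt hpΦ
      fun_prop
    have hev := hc.eventually_mem (by simpa using hN)
    filter_upwards [hev, Φ.open_source.mem_nhds hpΦ] with e he hes heM
    refine ⟨_, he, ?_⟩
    have heL : Φ e - Φ p ∈ L := L.sub_mem ((hML e hes).1 heM) hpL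
    have hpr := L.exists_continuous_projection.choose_spec ⟨_, heL⟩
    simp only at hpr
    have : α (ℓ.symm (L.exists_continuous_projection.choose (Φ e - Φ p))) = Φ e := by
      rw [hpr]
      simp [α, ι]
    change Φ.symm (α _) = e
    rw [this, Φ.left_inv hes]

end Parametrization

/-! ### Constant rank along the real points -/

section ConstantRank

/-- A linear map `T` whose rank is the dimension of `W` and for which `π ∘ T` maps a given copy of
`W` isomorphically is determined by `π ∘ T`. -/
theorem ContinuousLinearMap.comp_sub_inverse_eq_zero {V E W : Type*}
    [NormedAddCommGroup V] [NormedSpace ℂ V] [NormedAddCommGroup E] [NormedSpace ℂ E]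
    [FiniteDimensional ℂ E] [NormedAddCommGroup W] [NormedSpace ℂ W]
    (T : V →L[ℂ] E) (π : E →L[ℂ] W) (σ : W →L[ℂ] V)
    (hA : IsUnit ((π.comp T).comp σ)) (hT :
      finrank ℂ (LinearMap.range T.toLinearMap) = finrank ℂ W) :
    T.comp (ContinuousLinearMap.id ℂ V -
      (σ.comp (Ring.inverse ((π.comp T).comp σ))).comp (π.comp T)) = 0 := by
  set A := (π.comp T).comp σ with hAdef
  have hAr : ∀ w, A (Ring.inverse A w) = w := fun w =>
    DFunLike.congr_fun (Ring.mul_inverse_cancel A hA) w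
  let ρ : LinearMap.range T.toLinearMap →ₗ[ℂ] W :=
    π.toLinearMap.comp (LinearMap.range T.toLinearMap).subtype
  have hsurj : Function.Surjective ρ := fun w =>
    ⟨⟨T (σ (Ring.inverse A w)), LinearMap.mem_range_self _ _⟩, hAr w⟩
  have hfin : FiniteDimensional ℂ W := Module.Finite.of_surjective ρ hsurj
  -- Invertibility of `A` makes `π` surjective from the range of `T` to `W`. Equal dimensions make
  -- it injective there, so `π (T u) = 0` forces `T u = 0`.
  have hinj : Function.Injective ρ :=
    (LinearMap.injective_iff_surjective_of_finrank_eq_finrank hT).2 hsurj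
  ext v
  set u := v - σ (Ring.inverse A (π (T v))) with hu
  change T u = 0
  have hz : ρ ⟨T u, LinearMap.mem_range_self _ _⟩ = 0 := by
    change π (T u) = 0
    rw [hu, map_sub, map_sub, sub_eq_zero]
    exact (hAr (π (T v))).symm
  have := hinj (hz.trans (map_zero ρ).symm)
  exact congrArg Subtype.val this

variable {d : ℕ} {E : Type*} [NormedAddCommGroup E] [NormedSpace ℂ E] [FiniteDimensional ℂ E]

/-- The rank condition propagates from real to complex points: where the rank is constant along
`ℝ^d`, a projection onto the image at the origin detects the kernels nearby. -/
theorem AnalyticAt.eventually_ker_of_constant_rank_real {D : (Fin d → ℂ) → ((Fin d → ℂ) →L[ℂ] E)}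
    (hD : AnalyticAt ℂ D 0) {W : Submodule ℂ E} (hW : LinearMap.range (D 0).toLinearMap = W)
    (π : E →L[ℂ] W) (hπ : ∀ w : W, π w = w)
    (hk : ∀ᶠ x in 𝓝 (0 : Fin d → ℝ),
      finrank ℂ (LinearMap.range (D (realInclusion d x)).toLinearMap) = finrank ℂ W) :
    ∀ᶠ z in 𝓝 (0 : Fin d → ℂ), ∀ v, π (D z v) = 0 → D z v = 0 := by
  have := FiniteDimensional.complete ℂ E
  have := FiniteDimensional.complete ℂ W
  have hsurj : Function.Surjective (π.comp (D 0)).toLinearMap := fun w => by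
    have : (w : E) ∈ LinearMap.range (D 0).toLinearMap := hW ▸ w.2
    obtain ⟨v, hv⟩ := this
    refine ⟨v, ?_⟩
    change π (D 0 v) = w
    rw [show D 0 v = w from hv, hπ]
  obtain ⟨σ₀, hσ₀⟩ := LinearMap.exists_rightInverse_of_surjective _ (LinearMap.range_eq_top.2 hsurj)
  let σ : W →L[ℂ] (Fin d → ℂ) := LinearMap.toContinuousLinearMap σ₀
  let A : (Fin d → ℂ) → (W →L[ℂ] W) := fun z => (π.comp (D z)).comp σ
  have hA0 : A 0 = 1 := by
    ext w
    exact congrArg Subtype.val (LinearMap.congr_fun hσ₀ w)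
  have hAan : AnalyticAt ℂ A 0 :=
    (((ContinuousLinearMap.compL ℂ W (Fin d → ℂ) W).flip σ).comp
      (ContinuousLinearMap.compL ℂ (Fin d → ℂ) E W π)).analyticAt _ |>.comp hD
  have hAinv : AnalyticAt ℂ (fun z => Ring.inverse (A z)) 0 := by
    refine AnalyticAt.comp (g := Ring.inverse) ?_ hAan
    rw [hA0]
    exact analyticAt_inverse (𝕜 := ℂ) (A := W →L[ℂ] W) 1
  have hAunit : ∀ᶠ z in 𝓝 (0 : Fin d → ℂ), IsUnit (A z) :=
    by
    have : {a : W →L[ℂ] W | IsUnit a} ∈ 𝓝 (A 0) := by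
      rw [hA0]
      exact (Units.isOpen (R := W →L[ℂ] W)).mem_nhds isUnit_one
    exact hAan.continuousAt.eventually_mem this
  -- `R` is holomorphic and vanishes at real points, where the rank equals `dim W`; hence it
  -- vanishes near `0`. Where `π (D z v) = 0`, the correction term drops out and `R z v = D z v`.
  let R : (Fin d → ℂ) → ((Fin d → ℂ) →L[ℂ] E) := fun z =>
    (D z).comp (ContinuousLinearMap.id ℂ _ -
      (σ.comp (Ring.inverse (A z))).comp (π.comp (D z)))
  have hπD : AnalyticAt ℂ (fun z => π.comp (D z)) 0 :=
    (ContinuousLinearMap.compL ℂ (Fin d → ℂ) E W π).analyticAt _ |>.comp hD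
  have hσA : AnalyticAt ℂ (fun z => σ.comp (Ring.inverse (A z))) 0 :=
    (ContinuousLinearMap.compL ℂ W W (Fin d → ℂ) σ).analyticAt _ |>.comp hAinv
  have hmid : AnalyticAt ℂ (fun z => (σ.comp (Ring.inverse (A z))).comp (π.comp (D z))) 0 :=
    ((ContinuousLinearMap.compL ℂ (Fin d → ℂ) W (Fin d → ℂ)).analyticAt_bilinear _).comp
      (hσA.prod hπD)
  have hR : AnalyticAt ℂ R 0 :=
    ((ContinuousLinearMap.compL ℂ (Fin d → ℂ) (Fin d → ℂ) E).analyticAt_bilinear _).comp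
      (hD.prod (analyticAt_const.sub hmid))
  have hincl : Filter.Tendsto (realInclusion d) (𝓝 0) (𝓝 0) :=
    (realInclusion d).continuous.tendsto' 0 0 (map_zero _)
  have hR0 : ∀ᶠ z in 𝓝 (0 : Fin d → ℂ), R z = 0 := by
    refine hR.eventually_eq_zero_of_realInclusion ?_
    filter_upwards [hk, hincl.eventually hAunit] with x hx hxA
    exact (D (realInclusion d x)).comp_sub_inverse_eq_zero π σ hxA hx
  filter_upwards [hR0] with z hz v hv
  have h := DFunLike.congr_fun hz v
  simpa [R, hv] using h

/-- A holomorphic map whose rank along `ℝ^d` is constant maps a neighbourhood of the origin onto a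
neighbourhood of its value in a graph over the image of its derivative. -/
theorem AnalyticAt.exists_section_of_constant_rank_real {ψ : (Fin d → ℂ) → E}
    (hψ : AnalyticAt ℂ ψ 0) {k : ℕ}
    (hk : ∀ᶠ x in 𝓝 (0 : Fin d → ℝ),
      finrank ℂ (LinearMap.range (fderiv ℂ ψ (realInclusion d x)).toLinearMap) = k) :
    ∃ (W : Submodule ℂ E) (π : E →L[ℂ] W) (s : W → E), finrank ℂ W = k ∧ (∀ w : W, π w = w) ∧
      AnalyticAt ℂ s (π (ψ 0)) ∧ (∀ᶠ w in 𝓝 (π (ψ 0)), π (s w) = w) ∧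
      (∀ᶠ z in 𝓝 0, s (π (ψ z)) = ψ z) ∧
      ∀ N ∈ 𝓝 (0 : Fin d → ℂ), ∀ᶠ w in 𝓝 (π (ψ 0)), s w ∈ ψ '' N := by
  have := FiniteDimensional.complete ℂ E
  let W : Submodule ℂ E := LinearMap.range (fderiv ℂ ψ 0).toLinearMap
  have hWk : finrank ℂ W = k := by
    have := hk.self_of_nhds
    rwa [map_zero] at this
  obtain ⟨π, hπ⟩ := W.exists_continuous_projection
  have hker := hψ.fderiv.eventually_ker_of_constant_rank_real (W := W) rfl π hπ
    (by simpa only [hWk] using hk)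
  let f' : (Fin d → ℂ) →L[ℂ] W := π.comp (fderiv ℂ ψ 0)
  let K : Submodule ℂ (Fin d → ℂ) := LinearMap.ker f'.toLinearMap
  obtain ⟨q, hq⟩ := K.exists_continuous_projection
  let Θ' : (Fin d → ℂ) →L[ℂ] W × K := f'.prod q
  have hbij : Function.Bijective Θ'.toLinearMap := by
    constructor
    · refine (injective_iff_map_eq_zero _).2 fun v hv => ?_
      have h1 : f' v = 0 := congrArg Prod.fst hv
      have h2 : q v = 0 := congrArg Prod.snd hv
      have h3 := hq ⟨v, h1⟩
      rw [h2] at h3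
      exact (congrArg Subtype.val h3).symm
    · rintro ⟨⟨_, v, rfl⟩, u⟩
      have hu : f' u = 0 := u.2
      have hv : f' (q v) = 0 := (q v).2
      refine ⟨v + (u - q v), Prod.ext ?_ ?_⟩
      · change f' (v + (u - q v)) = _
        rw [map_add, map_sub, hu, hv, sub_zero, add_zero]
        exact hπ ⟨fderiv ℂ ψ 0 v, _⟩
      · change q (v + (u - q v)) = _
        rw [map_add, map_sub, hq, hq]
        abel
  let e : (Fin d → ℂ) ≃L[ℂ] W × K :=
    (LinearEquiv.ofBijective Θ'.toLinearMap hbij).toContinuousLinearEquiv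
  have he : (e : (Fin d → ℂ) →L[ℂ] W × K) = Θ' := by ext v <;> rfl
  -- Coordinates adapted to `ψ`: the first is `π ∘ ψ`, and the second completes it along the kernel
  -- of its derivative to a local biholomorphism. In them `ψ` will turn out not to depend on the
  -- second.
  let θ : (Fin d → ℂ) → W × K := fun z => (π (ψ z), q z)
  have hθan : ∀ z, AnalyticAt ℂ ψ z → AnalyticAt ℂ θ z := fun z hz =>
    ((π.analyticAt _).comp hz).prod (q.analyticAt z)
  have hθd : ∀ z, AnalyticAt ℂ ψ z → HasFDerivAt θ ((π.comp (fderiv ℂ ψ z)).prod q) z := fun z hz =>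
    (π.hasFDerivAt.comp z hz.differentiableAt.hasFDerivAt).prodMk q.hasFDerivAt
  have hθ0 : HasStrictFDerivAt θ (e : (Fin d → ℂ) →L[ℂ] W × K) 0 := by
    have h := (hθan 0 hψ).hasStrictFDerivAt
    rwa [(hθd 0 hψ).fderiv, show (π.comp (fderiv ℂ ψ 0)).prod q = _ from he.symm] at h
  let Θ : OpenPartialHomeomorph (Fin d → ℂ) (W × K) := hθ0.toOpenPartialHomeomorph θ
  have hΘ : (Θ : (Fin d → ℂ) → W × K) = θ := rfl
  have h0s : (0 : Fin d → ℂ) ∈ Θ.source := hθ0.mem_toOpenPartialHomeomorph_source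
  have hΘ0 : Θ 0 = (π (ψ 0), 0) := by
    rw [hΘ]
    simp [θ]
  have h0t : (π (ψ 0), (0 : K)) ∈ Θ.target := hΘ0 ▸ Θ.map_source h0s
  have hsymm0 : Θ.symm (π (ψ 0), 0) = 0 := by rw [← hΘ0, Θ.left_inv h0s]
  have hsan : AnalyticAt ℂ Θ.symm (π (ψ 0), 0) := by
    rw [← hΘ0]
    exact Θ.analyticAt_symm' (i := e) h0s (hθan 0 hψ) hθ0.hasFDerivAt.fderiv
  have hst : Filter.Tendsto Θ.symm (𝓝 (π (ψ 0), 0)) (𝓝 0) := by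
    simpa only [ContinuousAt, hsymm0] using hsan.continuousAt
  let G : W × K → E := fun y => ψ (Θ.symm y)
  have hinc : AnalyticAt ℂ (fun w : W => ((w, 0) : W × K)) (π (ψ 0)) :=
    analyticAt_id.prod analyticAt_const
  have hinct : Filter.Tendsto (fun w : W => ((w, 0) : W × K)) (𝓝 (π (ψ 0))) (𝓝 (π (ψ 0), 0)) :=
    hinc.continuousAt
  -- Moving in the `K` direction leaves `π ∘ ψ` fixed, so the derivative of `ψ` along it lies in the
  -- kernel of `π`, and `hker` kills it.
  have hG : ∀ᶠ y in 𝓝 (π (ψ 0), (0 : K)), ∃ G' : W × K →L[ℂ] E, HasFDerivAt G G' y ∧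
      ∀ u, G' (0, u) = 0 := by
    filter_upwards [hst.eventually hψ.eventually_analyticAt, hst.eventually hker,
      hsan.eventually_analyticAt, Θ.open_target.mem_nhds h0t] with y h1 h2 h3 h4
    refine ⟨(fderiv ℂ ψ (Θ.symm y)).comp (fderiv ℂ Θ.symm y),
      h1.differentiableAt.hasFDerivAt.comp y h3.differentiableAt.hasFDerivAt, fun u => h2 _ ?_⟩
    have hid := Θ.fderiv_comp_fderiv_symm (𝕜 := ℂ) h4 (hθan _ h1).differentiableAt
      h3.differentiableAt
    rw [hΘ, (hθd _ h1).fderiv] at hid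
    exact congrArg Prod.fst (DFunLike.congr_fun hid (0, u))
  obtain ⟨ε, hε, hGε⟩ := Metric.eventually_nhds_iff_ball.1 hG
  refine ⟨W, π, fun w => G (w, 0), hWk, hπ, ?_, ?_, ?_, ?_⟩
  · have h1 : AnalyticAt ℂ G (π (ψ 0), 0) :=
      AnalyticAt.comp (by rw [hsymm0]; exact hψ) hsan
    exact AnalyticAt.comp (g := G) h1 hinc
  · filter_upwards [hinct.eventually (Θ.open_target.mem_nhds h0t)] with w hw
    exact congrArg Prod.fst (Θ.right_inv hw)
  · have hΘt : Filter.Tendsto Θ (𝓝 0) (𝓝 (π (ψ 0), 0)) := by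
      rw [← hΘ0]
      exact Θ.continuousAt h0s
    filter_upwards [hΘt.eventually (Metric.ball_mem_nhds _ hε), Θ.open_source.mem_nhds h0s]
      with z hz hzs
    have hGz : G (Θ z) = ψ z := by
      change ψ (Θ.symm (Θ z)) = _
      rw [Θ.left_inv hzs]
    have hz1 : (Θ z).1 = π (ψ z) := rfl
    rw [← hz1, ← hGz]
    set w := (Θ z).1
    set r := (Θ z).2
    have hzeq : Θ z = (w, r) := rfl
    rw [hzeq] at hz ⊢
    -- Balls for the sup norm are products, so the slice through `w` is a ball of `K`. It is
    -- connected, and `G (w, ·)` has zero derivative on it.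
    rw [← Metric.mem_ball, ← ball_prod_same, Set.mem_prod] at hz
    have hderiv : ∀ r' ∈ Metric.ball (0 : K) ε, HasFDerivAt (fun r' => G (w, r'))
        (0 : K →L[ℂ] E) r' := by
      intro r' hr'
      obtain ⟨G', hG', hG0⟩ := hGε (w, r') (by
        rw [← ball_prod_same]
        exact ⟨hz.1, hr'⟩)
      have h := HasFDerivAt.comp (g := G) r' hG' (hasFDerivAt_prodMk_right w r')
      have hzero : G'.comp (ContinuousLinearMap.inr ℂ W K) = 0 :=
        ContinuousLinearMap.ext hG0
      rwa [hzero] at h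
    exact Metric.isOpen_ball.is_const_of_fderiv_eq_zero (𝕜 := ℂ) (convex_ball _ _).isPreconnected
      (fun r' hr' => (hderiv r' hr').differentiableAt.differentiableWithinAt)
      (fun r' hr' => (hderiv r' hr').fderiv) (Metric.mem_ball_self hε) hz.2
  · intro N hN
    filter_upwards [hinct.eventually (hst.eventually hN)] with w hw
    exact ⟨_, hw, rfl⟩

end ConstantRank

/-! ### Dimension of submanifolds and flattening of graphs -/

section Submanifold

variable {𝕜 : Type*} [NontriviallyNormedField 𝕜] {E : Type*} [NormedAddCommGroup E]
  [NormedSpace 𝕜 E]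

theorem OpenPartialHomeomorph.fderiv_injective (Φ : OpenPartialHomeomorph E E) {x : E}
    (hx : x ∈ Φ.source) (h₁ : DifferentiableAt 𝕜 Φ x) (h₂ : DifferentiableAt 𝕜 Φ.symm (Φ x)) :
    Function.Injective (fderiv 𝕜 Φ x) := by
  have h := Φ.symm.fderiv_comp_fderiv_symm (𝕜 := 𝕜) (a := x) hx h₂ h₁
  exact Function.LeftInverse.injective fun v => DFunLike.congr_fun h v

theorem IsAnalyticSubmanifold.inter_isOpen {d : ℕ} {M V : Set E}
    (hM : IsAnalyticSubmanifold 𝕜 d M) (hV : IsOpen V) : IsAnalyticSubmanifold 𝕜 d (M ∩ V) := by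
  rintro p ⟨hp, hpV⟩
  obtain ⟨Φ, L, hpΦ, hΦ, hΦs, hL, hML⟩ := hM p hp
  have hsource : (Φ.restr V).source = Φ.source ∩ V := by rw [Φ.restr_source, hV.interior_eq]
  refine ⟨Φ.restr V, L, ?_, ?_, ?_, hL, ?_⟩
  · rw [hsource]
    exact ⟨hpΦ, hpV⟩
  · intro x hx
    rw [hsource] at hx
    exact hΦ x hx.1
  · intro y hy
    have h1 := (Φ.restr V).map_target hy
    rw [hsource] at h1
    have h2 := (Φ.restr V).right_inv hy
    have h3 : y ∈ Φ.target := by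
      rw [← h2]
      exact Φ.map_source h1.1
    exact hΦs y h3
  · intro x hx
    rw [hsource] at hx
    exact ⟨fun h => (hML x hx.1).1 h.1, fun h => ⟨(hML x hx.1).2 h, hx.2⟩⟩

/-- At a common point the derivative of the transition map `Φ ∘ Ψ⁻¹` is injective, and it sends the
model space of `N` into that of `X`. -/
theorem IsAnalyticSubmanifold.dim_le_of_subset [CompleteSpace 𝕜] [FiniteDimensional 𝕜 E]
    {j k : ℕ} {N X : Set E} (hN : IsAnalyticSubmanifold 𝕜 j N) (hX : IsAnalyticSubmanifold 𝕜 k X)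
    (hNX : N ⊆ X) (hne : N.Nonempty) : j ≤ k := by
  obtain ⟨q, hq⟩ := hne
  obtain ⟨Ψ, L', hqΨ, hΨ, hΨs, rfl, hNL⟩ := hN q hq
  obtain ⟨Φ, L, hqΦ, hΦ, hΦs, rfl, hXL⟩ := hX q (hNX hq)
  have hqt := Ψ.map_source hqΨ
  have hqL : Ψ q ∈ L' := (hNL q hqΨ).1 hq
  have hA : Function.Injective (fderiv 𝕜 Φ q) := Φ.fderiv_injective hqΦ (hΦ q hqΦ).differentiableAt
    (hΦs _ (Φ.map_source hqΦ)).differentiableAt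
  have hB : Function.Injective (fderiv 𝕜 Ψ.symm (Ψ q)) := Ψ.symm.fderiv_injective hqt
    (hΨs _ hqt).differentiableAt (by
      rw [Ψ.symm_symm, Ψ.left_inv hqΨ]
      exact (hΨ q hqΨ).differentiableAt)
  let α : L' → E := fun l => Ψ q + l
  have hα : HasFDerivAt α L'.subtypeL 0 := L'.subtypeL.hasFDerivAt.const_add _
  have hα0 : α 0 = Ψ q := by simp [α]
  have hβ : HasFDerivAt (fun l => Ψ.symm (α l)) ((fderiv 𝕜 Ψ.symm (Ψ q)).comp L'.subtypeL) 0 := by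
    refine HasFDerivAt.comp (g := Ψ.symm) 0 ?_ hα
    rw [hα0]
    exact (hΨs _ hqt).differentiableAt.hasFDerivAt
  have hβ0 : Ψ.symm (α 0) = q := by rw [hα0, Ψ.left_inv hqΨ]
  have hc : HasFDerivAt (fun l => Φ (Ψ.symm (α l)))
      ((fderiv 𝕜 Φ q).comp ((fderiv 𝕜 Ψ.symm (Ψ q)).comp L'.subtypeL)) 0 := by
    refine HasFDerivAt.comp (g := Φ) 0 ?_ hβ
    rw [hβ0]
    exact (hΦ q hqΦ).differentiableAt.hasFDerivAt
  have h1 : ∀ᶠ l in 𝓝 (0 : L'), α l ∈ Ψ.target :=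
    hα.continuousAt.eventually_mem (Ψ.open_target.mem_nhds (by rwa [hα0]))
  have h2 : ∀ᶠ l in 𝓝 (0 : L'), Ψ.symm (α l) ∈ Φ.source :=
    hβ.continuousAt.eventually_mem (Φ.open_source.mem_nhds (by rwa [hβ0]))
  have hmem := L.mem_of_hasFDerivAt hc (by
    filter_upwards [h1, h2] with l hl1 hl2
    refine (hXL _ hl2).1 (hNX ((hNL _ (Ψ.map_target hl1)).2 ?_))
    rw [Ψ.right_inv hl1]
    exact L'.add_mem hqL l.2)
  let T : L' →ₗ[𝕜] L := LinearMap.codRestrict L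
    ((fderiv 𝕜 Φ q).comp ((fderiv 𝕜 Ψ.symm (Ψ q)).comp L'.subtypeL)).toLinearMap hmem
  refine LinearMap.finrank_le_finrank_of_injective (f := T) fun a b hab => ?_
  exact Subtype.val_injective (hB (hA (congrArg Subtype.val hab)))

/-- A graph over a linear subspace is flattened by an explicit analytic diffeomorphism. -/
theorem exists_flattening_of_section {W : Submodule 𝕜 E} (π : E →L[𝕜] W) (hπ : ∀ w : W, π w = w)
    {s : W → E} {p : E} (hs : ∀ᶠ w in 𝓝 (π p), AnalyticAt 𝕜 s w)
    (hsπ : ∀ᶠ w in 𝓝 (π p), π (s w) = w) :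
    ∃ Φ : OpenPartialHomeomorph E E, p ∈ Φ.source ∧ AnalyticOnNhd 𝕜 Φ Φ.source ∧
      AnalyticOnNhd 𝕜 Φ.symm Φ.target ∧ ∀ e ∈ Φ.source, Φ e ∈ W ↔ s (π e) = e := by
  obtain ⟨B, hB, hBo, hpB⟩ := eventually_nhds_iff.1 (hs.and hsπ)
  have hf : AnalyticOnNhd 𝕜 (fun e => e - s (π e) + π e) (π ⁻¹' B) := fun e he =>
    (analyticAt_id.sub (AnalyticAt.comp (hB _ he).1 (π.analyticAt e))).add
      ((W.subtypeL.comp π).analyticAt e)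
  have hg : AnalyticOnNhd 𝕜 (fun e => e + s (π e) - π e) (π ⁻¹' B) := fun e he =>
    (analyticAt_id.add (AnalyticAt.comp (hB _ he).1 (π.analyticAt e))).sub
      ((W.subtypeL.comp π).analyticAt e)
  have hπf : ∀ e ∈ π ⁻¹' B, π (e - s (π e) + π e) = π e := fun e he => by
    rw [map_add, map_sub, (hB _ he).2, hπ]
    abel
  have hπg : ∀ e ∈ π ⁻¹' B, π (e + s (π e) - π e) = π e := fun e he => by
    rw [map_sub, map_add, (hB _ he).2, hπ]
    abel
  -- A shear: `s w - w` lies in `ker π` for `w ∈ B`, so `π` is preserved. Hence the opposite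
  -- translation is the inverse, and source and target are both `π ⁻¹' B`.
  let Φ : OpenPartialHomeomorph E E :=
    { toFun := fun e => e - s (π e) + π e
      invFun := fun e => e + s (π e) - π e
      source := π ⁻¹' B
      target := π ⁻¹' B
      map_source' := fun e he => by
        change π _ ∈ B
        rw [hπf e he]
        exact he
      map_target' := fun e he => by
        change π _ ∈ B
        rw [hπg e he]
        exact he
      left_inv' := fun e he => by
        simp only [hπf e he]
        abel
      right_inv' := fun e he => by
        simp only [hπg e he]
        abel
      open_source := hBo.preimage π.continuous
      open_target := hBo.preimage π.continuous
      continuousOn_toFun := hf.continuousOn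
      continuousOn_invFun := hg.continuousOn }
  refine ⟨Φ, hpB, hf, hg, fun e he => ?_⟩
  change e - s (π e) + π e ∈ W ↔ _
  rw [W.add_mem_iff_left (π e).2]
  constructor
  · intro h
    have h1 := hπ ⟨_, h⟩
    rw [map_sub, (hB _ he).2, sub_self] at h1
    exact (sub_eq_zero.1 (congrArg Subtype.val h1).symm).symm
  · intro h
    rw [h, sub_self]
    exact W.zero_mem

end Submanifold

/-! ### The holomorphic closure and its dimension -/

section Germ

variable {E : Type*} [NormedAddCommGroup E] [NormedSpace ℂ E] [FiniteDimensional ℂ E]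

/-- Coordinates on the quotient `E ⧸ L`, composed with the flattening map, are local equations. -/
theorem IsAnalyticSubmanifold.isComplexAnalyticGerm {k : ℕ} {X : Set E}
    (hX : IsAnalyticSubmanifold ℂ k X) {p : E} (hp : p ∈ X) : IsComplexAnalyticGerm X p := by
  obtain ⟨Φ, L, hpΦ, hΦ, -, -, hXL⟩ := hX p hp
  let b := Module.finBasis ℂ (E ⧸ L)
  let ℓ : Fin (finrank ℂ (E ⧸ L)) → E →L[ℂ] ℂ := fun i =>
    LinearMap.toContinuousLinearMap ((b.coord i).comp L.mkQ)
  refine ⟨finrank ℂ (E ⧸ L), fun i e => ℓ i (Φ e), fun i =>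
    AnalyticAt.comp ((ℓ i).analyticAt _) (hΦ p hpΦ), ?_⟩
  filter_upwards [Φ.open_source.mem_nhds hpΦ] with e he
  rw [hXL e he, ← Submodule.Quotient.mk_eq_zero L, ← b.forall_coord_eq_zero_iff]
  rfl

/-- For the upper bound, shrink until `X` lies in `X₀` and compare dimensions of submanifolds. For
the lower bound, open pieces of `X₀` around `p` lie in `X` inside every neighbourhood. -/
theorem complexGermDim_eq_of_isAnalyticSubmanifold {k : ℕ} {X₀ X : Set E} {p : E}
    (hX₀ : IsAnalyticSubmanifold ℂ k X₀) (hp : p ∈ X₀) (h₁ : GermSubset p X X₀)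
    (h₂ : GermSubset p X₀ X) : complexGermDim X p = ((k : ℕ∞) : WithBot ℕ∞) := by
  apply le_antisymm
  · obtain ⟨U, hU, hUo, hpU⟩ := eventually_nhds_iff.1 h₁
    refine ((iInf_le _ U).trans ((iInf_le _ hUo).trans (iInf_le _ hpU))).trans ?_
    refine iSup_le fun j => iSup_le ?_
    rintro ⟨N, hne, hNX, hN⟩
    have := hN.dim_le_of_subset hX₀ (fun x hx => hU x (hNX hx).2 (hNX hx).1) hne
    exact_mod_cast this
  · obtain ⟨V, hV, hVo, hpV⟩ := eventually_nhds_iff.1 h₂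
    refine le_iInf fun U => le_iInf fun hUo => le_iInf fun hpU => ?_
    refine le_iSup_of_le (f := fun j : ℕ => ⨆ _ : ∃ N : Set E, N.Nonempty ∧ N ⊆ X ∩ U ∧
      IsAnalyticSubmanifold ℂ j N, ((j : ℕ∞) : WithBot ℕ∞)) k (le_iSup_of_le ?_ le_rfl)
    exact ⟨X₀ ∩ (V ∩ U), ⟨p, hp, hpV, hpU⟩, fun x hx => ⟨hV x hx.2.1 hx.1, hx.2.2⟩,
      hX₀.inter_isOpen (hVo.inter hUo)⟩

/-- The complexified parametrization of a CR manifold has constant rank at real points. -/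
theorem finrank_range_fderiv_complexification {d m : ℕ} {M : Set E}
    (hM : ∀ q ∈ M, HasCRDim (tangentSubspace M q) m) {γ : (Fin d → ℝ) → E}
    (hγ : ∀ᶠ x in 𝓝 (0 : Fin d → ℝ), γ x ∈ M ∧ Function.Injective (fderiv ℝ γ x) ∧
      tangentSubspace M (γ x) = LinearMap.range (fderiv ℝ γ x).toLinearMap)
    {ψ : (Fin d → ℂ) → E} (hψ : AnalyticAt ℂ ψ 0)
    (hψγ : ∀ᶠ x in 𝓝 (0 : Fin d → ℝ), ψ (realInclusion d x) = γ x) :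
    ∀ᶠ x in 𝓝 (0 : Fin d → ℝ),
      m + finrank ℂ (LinearMap.range (fderiv ℂ ψ (realInclusion d x)).toLinearMap) = d := by
  have hincl : Filter.Tendsto (realInclusion d) (𝓝 0) (𝓝 0) :=
    (realInclusion d).continuous.tendsto' 0 0 (map_zero _)
  filter_upwards [hγ, hψγ.eventually_nhds, hincl.eventually hψ.eventually_analyticAt]
    with x ⟨hxM, hinj, hT⟩ hx hψx
  set D := fderiv ℂ ψ (realInclusion d x) with hD
  have hγd : HasFDerivAt γ ((D.restrictScalars ℝ).comp (realInclusion d)) x := by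
    refine HasFDerivAt.congr_of_eventuallyEq (f := fun x => ψ (realInclusion d x)) ?_ ?_
    · exact HasFDerivAt.comp (g := ψ) x
        (hψx.differentiableAt.hasFDerivAt.restrictScalars ℝ) (realInclusion d).hasFDerivAt
    · filter_upwards [hx] with y hy using hy.symm
  have hDγ : ∀ v, fderiv ℝ γ x v = D (realInclusion d v) := fun v => by rw [hγd.fderiv]; rfl
  -- `D` is complex linear and restricts to `dγ` on `ℝ^d`, which spans `ℂ^d` over `ℂ`.
  have hspan : LinearMap.range D.toLinearMap =
      Submodule.span ℂ (tangentSubspace M (γ x) : Set E) := by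
    rw [hT]
    apply le_antisymm
    · rintro _ ⟨v, rfl⟩
      have hv : v = realInclusion d (fun i => (v i).re) +
          Complex.I • realInclusion d (fun i => (v i).im) := by
        ext i
        simp only [Pi.add_apply, Pi.smul_apply, realInclusion_apply, smul_eq_mul]
        rw [mul_comm, Complex.re_add_im]
      change D v ∈ _
      rw [hv, map_add, map_smul, ← hDγ, ← hDγ]
      exact Submodule.add_mem _ (Submodule.subset_span ⟨_, rfl⟩)
        (Submodule.smul_mem _ _ (Submodule.subset_span ⟨_, rfl⟩))
    · refine Submodule.span_le.2 ?_
      rintro _ ⟨v, rfl⟩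
      exact ⟨realInclusion d v, (hDγ v).symm⟩
  rw [hspan, (hM _ hxM).add_finrank_span, hT, LinearMap.finrank_range_of_inj hinj]
  simp

/-- The witness is the graph of `s` near `p`, which is the local image of the complexified
parametrization. The bound `m ≤ d` makes `d - m` a genuine difference. -/
theorem IsRealAnalyticCRManifold.exists_isHolomorphicClosureGerm {d m : ℕ} {M : Set E}
    (hM : IsRealAnalyticCRManifold d m M) {p : E} (hp : p ∈ M) :
    m ≤ d ∧ ∃ X : Set E, IsHolomorphicClosureGerm M p X ∧ p ∈ X ∧
      IsAnalyticSubmanifold ℂ (d - m) X := by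
  have := FiniteDimensional.complexToReal E
  have := FiniteDimensional.complete ℂ E
  obtain ⟨γ, hγa, hγ0, hγM, hγs⟩ := hM.1.exists_parametrization hp
  obtain ⟨ψ, hψ, hψγ⟩ := hγa.exists_complexification
  have hrank := finrank_range_fderiv_complexification hM.2 hγM hψ hψγ
  have hψ0 : ψ 0 = p := by
    have := hψγ.self_of_nhds
    rwa [map_zero, hγ0] at this
  refine ⟨by have := hrank.self_of_nhds; omega, ?_⟩
  obtain ⟨W, π, s, hW, hπ, hs, hsπ, hsψ, hψs⟩ :=
    hψ.exists_section_of_constant_rank_real (k := d - m)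
      (by filter_upwards [hrank] with x hx; omega)
  rw [hψ0] at hs hsπ hψs
  obtain ⟨Φ, hpΦ, hΦ, hΦs, hΦW⟩ := exists_flattening_of_section π hπ hs.eventually_analyticAt hsπ
  have hpX : Φ p ∈ W := by
    rw [hΦW p hpΦ, ← hψ0]
    exact hsψ.self_of_nhds
  have hincl : Filter.Tendsto (realInclusion d) (𝓝 0) (𝓝 0) :=
    (realInclusion d).continuous.tendsto' 0 0 (map_zero _)
  have hγt : Filter.Tendsto γ (𝓝 0) (𝓝 p) := by
    simpa only [ContinuousAt, hγ0] using hγa.continuousAt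
  have hψt : Filter.Tendsto ψ (𝓝 0) (𝓝 p) := by
    simpa only [ContinuousAt, hψ0] using hψ.continuousAt
  have hX : IsAnalyticSubmanifold ℂ (d - m) {e | e ∈ Φ.source ∧ Φ e ∈ W} := fun e he =>
    ⟨Φ, W, he.1, hΦ, hΦs, hW, fun x hx => ⟨fun h => h.2, fun h => ⟨hx, h⟩⟩⟩
  refine ⟨{e | e ∈ Φ.source ∧ Φ e ∈ W}, ⟨⟨hX.isComplexAnalyticGerm ⟨hpΦ, hpX⟩, ?_⟩, ?_⟩,
    ⟨hpΦ, hpX⟩, hX⟩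
  · filter_upwards [hγs _ ((hγt.eventually (Φ.open_source.mem_nhds hpΦ)).and
      (hψγ.and (hincl.eventually hsψ)))] with e he heM
    obtain ⟨x, ⟨h1, h2, h3⟩, rfl⟩ := he heM
    refine ⟨h1, (hΦW _ h1).2 ?_⟩
    rwa [h2] at h3
  · rintro Y ⟨t, g, hg, hgY⟩ hMY
    -- The equations of `Y`, pulled back by `ψ`, vanish on `ℝ^d` because `Y` contains `M` near `p`.
    have hvan : ∀ i, ∀ᶠ z in 𝓝 (0 : Fin d → ℂ), g i (ψ z) = 0 := fun i => by
      refine AnalyticAt.eventually_eq_zero_of_realInclusion (F := fun z => g i (ψ z))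
        (AnalyticAt.comp (by rw [hψ0]; exact hg i) hψ) ?_
      filter_upwards [hγM, hψγ, hγt.eventually hMY, hγt.eventually hgY] with x h1 h2 h3 h4
      rw [h2]
      exact h4.1 (h3 h1.1) i
    have hψY : ∀ᶠ z in 𝓝 (0 : Fin d → ℂ), ψ z ∈ Y := by
      filter_upwards [Filter.eventually_all.2 hvan, hψt.eventually hgY] with z h1 h2
      exact h2.2 h1
    -- A point `e` of the graph equals `s (π e)`, which for `e` near `p` is a value of `ψ` at a
    -- parameter that `ψ` sends into `Y`.
    filter_upwards [(π.continuous.tendsto p).eventually (hψs _ hψY)] with e he heX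
    rw [(hΦW e heX.1).1 heX.2] at he
    obtain ⟨z, hz, rfl⟩ := he
    exact hz

end Germ

theorem proposition1p4 (n d m : ℕ) (M : Set (EuclideanSpace ℂ (Fin n)))
    (hM : IsRealAnalyticCRManifold d m M) (p : EuclideanSpace ℂ (Fin n)) (hp : p ∈ M) :
    m ≤ d ∧ HasHolomorphicClosureDim M p (d - m) := by
  obtain ⟨hmd, X₀, hX₀, hpX₀, hX₀s⟩ := hM.exists_isHolomorphicClosureGerm hp
  refine ⟨hmd, ⟨X₀, hX₀⟩, fun X hX => ?_⟩
  -- Minimality of `X` and of `X₀` gives both germ inclusions, so the dimension may be computed on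
  -- the submanifold `X₀`.
  exact complexGermDim_eq_of_isAnalyticSubmanifold hX₀s hpX₀ (hX.2 X₀ hX₀.1.1 hX₀.1.2)
    (hX₀.2 X hX.1.1 hX.1.2)
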